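/- Let $G$ be a finite nilpotent group such that, for every prime $p$ dividing $|G|$, the Sylow $p$-subgroup of $G$ is neither cyclic nor a generalized quaternion group $Q_{2^k}$ ($k\ge 3$). Let $\mathcal{G}_E(G)$ be the enhanced power graph of $G$: its vertex set is $G$, and two distinct elements $x,y$ are adjacent if and only if $x,y\in\langle w\rangle$ for some $w\in G$. Let $\mathcal{G}_E^{**}(G)$ be the proper enhanced power graph, that is, the induced subgraph obtained from $\mathcal{G}_E(G)$ by deleting all dominating vertices (the vertices adjacent to every other vertex). A total dominating set of a graph $\Gamma=(V,E)$ is a set $D\subseteq V$ such that every vertex of $V$, including those in $D$, has a neighbour in $D$; the strong domination number $\gamma^{\mathrm{strong}}(\Gamma)$ is the minimum cardinality of a total dominating set of $\Gamma$ (and $\infty$ if there is none). 1. If $G$ is a $p$-group with exactly $r$ subgroups of order $p$, and $\mathcal{G}_E^{**}(G)$ possesses a total dominating set, then $\gamma^{\mathrm{strong}}(\mathcal{G}_E^{**}(G))=2r$. 2. If $|G|$ has $m\ge 2$ distinct prime divisors $p_1,\dots,p_m$, so that $G=P_1\times\cdots\times P_m$ with $P_i$ the Sylow $p_i$-subgroup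 of $G$, and $r_i$ is the number of subgroups of order $p_i$ in $P_i$, then $\mathcal{G}_E^{**}(G)$ possesses a total dominating set and $\gamma^{\mathrm{strong}}(\mathcal{G}_E^{**}(G))=\left(\min_{1\le i\le m} r_i\right)+1$. -/

import Mathlib

/-- The enhanced power graph of `G`: distinct `x`, `y` are adjacent iff they lie in a common
cyclic subgroup of `G`. -/
def enhancedPowerGraph (G : Type*) [Group G] : SimpleGraph G where
  Adj x y := x ≠ y ∧ ∃ w : G, x ∈ Subgroup.zpowers w ∧ y ∈ Subgroup.zpowers w
  symm := ⟨fun _ _ h => ⟨h.1.symm, h.2.imp fun _ hw => ⟨hw.2, hw.1⟩⟩⟩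
  loopless := ⟨fun _ h => h.1 rfl⟩

/-- The proper enhanced power graph: the enhanced power graph with all its dominating vertices
(the vertices adjacent to every other vertex, `SimpleGraph.universalVerts`) deleted. -/
def properEnhancedPowerGraph (G : Type*) [Group G] :
    SimpleGraph ↥((enhancedPowerGraph G).universalVertsᶜ) :=
  (enhancedPowerGraph G).induce (enhancedPowerGraph G).universalVertsᶜ

/-- A total (strongly) dominating set: every vertex of the graph, including those of `D`,
has a neighbour in `D`. -/
def IsTotalDominatingSet {V : Type*} (Γ : SimpleGraph V) (D : Set V) : Prop :=
  ∀ u : V, ∃ v ∈ D, Γ.Adj u v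

/-- The strong domination number: the least cardinality of a total dominating set; it is `⊤`
if the graph has no total dominating set. -/
noncomputable def strongDominationNumber {V : Type*} (Γ : SimpleGraph V) : ℕ∞ :=
  ⨅ D : {D : Set V // IsTotalDominatingSet Γ D}, D.1.encard

/-- `G` is a generalized quaternion group `Q_{2^k}` with `k ≥ 3`. Mathlib's `QuaternionGroup n`
has order `4 * n`, so `Q_{2^k}` is `QuaternionGroup (2 ^ (k - 2))`. -/
def IsGeneralizedQuaternion (G : Type*) [Group G] : Prop :=
  ∃ k : ℕ, 3 ≤ k ∧ Nonempty (G ≃* QuaternionGroup (2 ^ (k - 2)))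

/-- The number of subgroups of order `p` of `G`. -/
noncomputable def numSubgroupsOfOrder (p : ℕ) (G : Type*) [Group G] : ℕ :=
  Nat.card {H : Subgroup G // Nat.card H = p}

/-! A finite cyclic group has at most one subgroup of each order, so adjacent elements share their
subgroup of order `p` whenever both have one (`eq_of_adj`). Hence a dominating vertex other than `1`
would leave some Sylow `p`-subgroup with a single subgroup of order `p`, making it cyclic or
generalized quaternion; under the hypotheses only `1` is deleted.

In a `p`-group the remaining vertices split, with no edges between classes, according to their
subgroup of order `p`. Each of the `r` classes needs two adjacent vertices of the dominating set,
and a generator of the subgroup with one neighbour suffices.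

With several primes, elements of coprime orders commute and are adjacent. Generators of all
subgroups of order `p`, plus one element of order `q ≠ p`, dominate. Conversely, attach to each
vertex of a total dominating set a prime-order subgroup that it generates a multiple of; if for
every prime some subgroup were missed, a cyclic group containing one missed subgroup per prime would
have an undominated generator. So all subgroups of some order `p` occur, and an edge inside the set
yields one extra vertex. -/

/-! ### `p`-groups with at most one subgroup of order `p`. -/

/-- In a finite `p`-group, a nontrivial normal subgroup meets the centre nontrivially. -/
theorem IsPGroup.exists_mem_center_of_normal {G : Type*} [Group G] [Finite G] {p : ℕ}
    [Fact p.Prime] (hG : IsPGroup p G) (N : Subgroup G) [N.Normal] (hN : N ≠ ⊥) :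
    ∃ x ∈ N, x ∈ Subgroup.center G ∧ x ≠ 1 := by
  have hC : IsPGroup p (ConjAct G) := hG.of_equiv ConjAct.toConjAct
  have hd : p ∣ Nat.card N := by
    rcases (hG.to_subgroup N).card_eq_or_dvd with h | h
    · exact absurd (Subgroup.card_eq_one.mp h) hN
    · exact h
  -- The number of fixed points of conjugation on `N` is divisible by `p`, so the fixed point `1`
  -- forces another.
  have h1 : (1 : N) ∈ MulAction.fixedPoints (ConjAct G) N := fun g => by simp
  obtain ⟨x, hx, hne⟩ := hC.exists_fixed_point_of_prime_dvd_card_of_fixed_point N hd h1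
  refine ⟨x, x.2, Subgroup.mem_center_iff.mpr fun g => ?_, fun h => hne (Subtype.ext h.symm)⟩
  have h2 := congrArg Subtype.val (hx (ConjAct.toConjAct g))
  simp only [ConjAct.Subgroup.val_conj_smul, ConjAct.smul_def, ConjAct.ofConjAct_toConjAct] at h2
  exact mul_inv_eq_iff_eq_mul.mp h2

theorem conj_zpow_of_conj {G : Type*} [Group G] {a b : G} {s : ℤ} (h : b * a * b⁻¹ = a ^ s)
    (k : ℤ) : b * a ^ k = a ^ (s * k) * b := by
  rw [zpow_mul, ← h, conj_zpow]; group

theorem conj_pow_of_conj {G : Type*} [Group G] {a b : G} {s : ℤ} (h : b * a * b⁻¹ = a ^ s)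
    (m : ℕ) : b ^ m * a * (b ^ m)⁻¹ = a ^ (s ^ m) := by
  induction m with
  | zero => simp
  | succ m ih =>
    have : b ^ (m + 1) * a * (b ^ (m + 1))⁻¹ = b * (b ^ m * a * (b ^ m)⁻¹) * b⁻¹ := by
      rw [pow_succ']; group
    rw [this, ih, conj_zpow_of_conj h, pow_succ']; group

/-- The exponent sum is the norm of the action of `b` on `⟨a⟩`; it tells which elements of the coset
of `b` have trivial `m`-th power. -/
theorem zpow_mul_pow_of_conj {G : Type*} [Group G] {a b : G} {s : ℤ} (h : b * a * b⁻¹ = a ^ s)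
    (j : ℤ) (m : ℕ) :
    (a ^ j * b) ^ m = a ^ (j * ∑ i ∈ Finset.range m, s ^ i) * b ^ m := by
  induction m with
  | zero => simp
  | succ m ih =>
    rw [pow_succ', ih, mul_assoc, ← mul_assoc b, conj_zpow_of_conj h, Finset.sum_range_succ',
      mul_assoc (a ^ (s * _)), ← pow_succ', ← mul_assoc, ← zpow_add]
    congr 2
    simp only [pow_succ', ← Finset.mul_sum]
    ring

/-- If `b` normalizes a cyclic `p`-group `⟨a⟩` containing all elements of order `p`, lies outside
of it while its `p`-th power lies inside, and the relevant norm has `p`-adic valuation one, then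
`a` is a power of `b`. -/
theorem mem_zpowers_of_conj_of_norm {G : Type*} [Group G] {p : ℕ} (hp : p.Prime) {n : ℕ} {a b : G}
    (ha : orderOf a = p ^ n) (hU : ∀ x : G, x ^ p = 1 → x ∈ Subgroup.zpowers a)
    (hb : b ∉ Subgroup.zpowers a) (hbp : b ^ p ∈ Subgroup.zpowers a) {s u : ℤ}
    (h : b * a * b⁻¹ = a ^ s) (hN : ∑ i ∈ Finset.range p, s ^ i = p * u)
    (hu : ¬ (p : ℤ) ∣ u) : a ∈ Subgroup.zpowers b := by
  have hpZ : Prime (p : ℤ) := Nat.prime_iff_prime_int.mp hp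
  obtain ⟨k, hk⟩ := Subgroup.mem_zpowers_iff.mp hbp
  have hcop : ∀ v : ℤ, ¬ (p : ℤ) ∣ v → IsCoprime v ((p : ℤ) ^ n) := fun v hv =>
    ((hpZ.coprime_iff_not_dvd.mpr hv).symm).pow_right
  have hapow : a ^ ((p : ℤ) ^ n) = 1 := by
    have := pow_orderOf_eq_one a
    rw [ha] at this; exact_mod_cast this
  by_cases hpk : (p : ℤ) ∣ k
  · obtain ⟨k', rfl⟩ := hpk
    obtain ⟨x, y, hxy⟩ := hcop u hu
    exfalso
    -- As `x` inverts `u` modulo `p ^ n`, the norm of `-(k' * x)` is `-(p * k')` modulo `p ^ n`,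
    -- which cancels `b ^ p = a ^ (p * k')`. A coset element killed by `p` contradicts `hU`.
    have h1 : (a ^ (-(k' * x)) * b) ^ p = 1 := by
      rw [zpow_mul_pow_of_conj h, hN, ← hk, ← zpow_add]
      have : -(k' * x) * (p * u) + p * k' = (p : ℤ) ^ n * (p * k' * y) := by
        linear_combination (- p * k') * hxy
      rw [this, zpow_mul, hapow, one_zpow]
    have h2 := hU _ h1
    exact hb ((Subgroup.mul_mem_cancel_left _
      (Subgroup.zpow_mem _ (Subgroup.mem_zpowers a) _)).mp h2)
  -- Here `k` is prime to `p`, so `b ^ p = a ^ k` already generates `⟨a⟩`.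
  · obtain ⟨x, y, hxy⟩ := hcop k hpk
    refine Subgroup.mem_zpowers_iff.mpr ⟨p * x, ?_⟩
    rw [zpow_mul, zpow_natCast, ← hk, ← zpow_mul]
    have : k * x = 1 + (p : ℤ) ^ n * (-y) := by linear_combination hxy
    rw [this, zpow_add, zpow_mul, hapow]; simp

/-- A normal cyclic subgroup of maximal order in a finite `p`-group with at most one subgroup of
order `p` is its own centralizer. -/
theorem IsPGroup.mem_zpowers_of_commute_of_maximal {G : Type*} [Group G] [Finite G] {p : ℕ}
    [hp : Fact p.Prime] (hG : IsPGroup p G) {a : G} [hA : (Subgroup.zpowers a).Normal]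
    (hU : ∀ x : G, x ^ p = 1 → x ∈ Subgroup.zpowers a)
    (hmax : ∀ c : G, (Subgroup.zpowers c).Normal → orderOf c ≤ orderOf a)
    {g : G} (hg : Commute g a) : g ∈ Subgroup.zpowers a := by
  by_contra hga
  set A := Subgroup.zpowers a with hAdef
  let C : Subgroup G := Subgroup.centralizer (A : Set G)
  have memC : ∀ x : G, x ∈ C ↔ Commute x a := fun x => by
    rw [Subgroup.mem_centralizer_iff]
    refine ⟨fun h => (h a (Subgroup.mem_zpowers a)).symm, fun h y hy => ?_⟩
    obtain ⟨k, rfl⟩ := Subgroup.mem_zpowers_iff.mp hy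
    exact (h.zpow_right k).symm.eq
  let π := QuotientGroup.mk' A
  have : (C.map π).Normal := Subgroup.Normal.map inferInstance π (QuotientGroup.mk'_surjective A)
  have hne : C.map π ≠ ⊥ := fun h => hga <| by
    have : π g ∈ C.map π := ⟨g, (memC g).mpr hg, rfl⟩
    rw [h, Subgroup.mem_bot] at this
    exact (QuotientGroup.eq_one_iff g).mp this
  have hQ : IsPGroup p (G ⧸ A) := hG.to_quotient A
  -- A central element of order `p` in the quotient lifts to `x` centralizing `a`. Then `⟨x⟩`
  -- properly contains `⟨a⟩` and is normal, against maximality.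
  obtain ⟨y, hyC, hyZ, hy1⟩ := hQ.exists_mem_center_of_normal (C.map π) hne
  obtain ⟨m, hm⟩ := hQ.dvd_orderOf hy1
  have hord : orderOf (y ^ m) = p := by
    refine orderOf_pow_of_dvd ?_ ⟨p, by rw [hm, mul_comm]⟩ |>.trans ?_
    · rintro rfl; exact (orderOf_pos y).ne' (by simpa using hm)
    · rw [hm]; exact Nat.mul_div_cancel _ (Nat.pos_of_ne_zero (by
        rintro rfl; exact (orderOf_pos y).ne' (by simpa using hm)))
  obtain ⟨x, hxC, hx⟩ := Subgroup.pow_mem _ hyC m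
  have hxa : Commute x a := (memC x).mp hxC
  have hxA : x ∉ A := fun h => by
    have : π x = 1 := (QuotientGroup.eq_one_iff x).mpr h
    rw [← hx, this, orderOf_one] at hord
    exact hp.out.one_lt.ne hord
  have hxp : x ^ p ∈ A := by
    refine (QuotientGroup.eq_one_iff _).mp ?_
    change π (x ^ p) = 1
    rw [map_pow, hx, ← hord, pow_orderOf_eq_one]
  obtain ⟨n, hn⟩ := (IsPGroup.iff_orderOf.mp hG) a
  -- For the trivial action the norm is `p` itself.
  have hax : a ∈ Subgroup.zpowers x := by
    refine mem_zpowers_of_conj_of_norm hp.out (s := 1) (u := 1) hn hU hxA hxp ?_ (by simp) ?_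
    · rw [hxa.eq]; simp
    · exact fun h => hp.out.one_lt.ne' (by exact_mod_cast Int.eq_one_of_dvd_one (by positivity) h)
  have hAx : A ≤ Subgroup.zpowers x := by rwa [hAdef, Subgroup.zpowers_le]
  have hnorm : (Subgroup.zpowers x).Normal := by
    refine ⟨fun z hz g => ?_⟩
    have key : g * x * g⁻¹ ∈ Subgroup.zpowers x := by
      have h1 : π (x⁻¹ * (g * x * g⁻¹)) = 1 := by
        have := Subgroup.mem_center_iff.mp (Subgroup.pow_mem _ hyZ m) (π g)
        rw [← hx] at this
        rw [map_mul, map_mul, map_mul, this]; simp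
      have h2 := hAx ((QuotientGroup.eq_one_iff _).mp h1)
      exact (Subgroup.mul_mem_cancel_left _ (inv_mem (Subgroup.mem_zpowers x))).mp h2
    obtain ⟨k, rfl⟩ := Subgroup.mem_zpowers_iff.mp hz
    rw [← conj_zpow]
    exact Subgroup.zpow_mem _ key k
  have hle := hmax x hnorm
  rw [← Nat.card_zpowers, ← Nat.card_zpowers] at hle
  exact hxA ((Subgroup.eq_of_le_of_card_ge hAx hle).symm ▸ Subgroup.mem_zpowers x)

/-- For odd `p` the sum is congruent to `p` modulo `p ^ 2`. This fails for `p = 2`, `s = 3`, which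
is where quaternion groups arise. -/
theorem exists_sum_pow_eq_mul_of_modEq_one {p : ℕ} (hp : p.Prime) (hodd : p ≠ 2) {s : ℤ}
    (hs : (p : ℤ) ∣ s - 1) :
    ∃ u : ℤ, ∑ i ∈ Finset.range p, s ^ i = p * u ∧ ¬ (p : ℤ) ∣ u := by
  obtain ⟨t, ht⟩ := hs
  obtain ⟨v, hv⟩ := odd_sq_dvd_geom_sum₂_sub (a := (1 : ℤ)) (b := t) (hp.odd_of_ne_two hodd)
  have hst : 1 + (p : ℤ) * t = s := by linarith
  simp only [one_pow, mul_one, hst] at hv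
  refine ⟨1 + p * v, by linarith, fun h => ?_⟩
  have h1 : (p : ℤ) ∣ 1 := (Int.dvd_add_left (dvd_mul_right _ _)).mp h
  exact hp.one_lt.ne' (by exact_mod_cast Int.eq_one_of_dvd_one (by positivity) h1)

/-- A finite group generated by `a` of order `2m` and `b` inverting `a` with `b² = aᵐ`, in which
every element lies in `⟨a⟩` or in its coset by `b`, is a quaternion group. -/
theorem nonempty_mulEquiv_quaternionGroup {G : Type*} [Group G] {m : ℕ} {a b : G}
    (ha : orderOf a = 2 * m) (hb : b ∉ Subgroup.zpowers a) (hinv : b * a * b⁻¹ = a⁻¹)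
    (hsq : b ^ 2 = a ^ m) (hcov : ∀ g : G, g ∉ Subgroup.zpowers a → b⁻¹ * g ∈ Subgroup.zpowers a) :
    Nonempty (G ≃* QuaternionGroup m) := by
  -- Exponents are lifted to integers; `he` shows that the lift does not matter because `a` has
  -- order `2 * m`.
  let e : ZMod (2 * m) → G := fun i => a ^ (i.cast : ℤ)
  have he : ∀ k : ℤ, e (k : ZMod (2 * m)) = a ^ k := fun k => by
    change a ^ _ = a ^ _
    rw [← zpow_mod_orderOf a k, ha, ZMod.coe_intCast]
  have hsurj : ∀ i : ZMod (2 * m), ∃ k : ℤ, (k : ZMod (2 * m)) = i := ZMod.intCast_surjective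
  have hinv' : b * a * b⁻¹ = a ^ (-1 : ℤ) := by simpa using hinv
  have hcomm : ∀ k : ℤ, a ^ k * b = b * a ^ (-k) := fun k => by
    rw [conj_zpow_of_conj hinv']; simp
  let f : QuaternionGroup m → G := fun q => match q with
    | .a i => e i
    | .xa i => b * e i
  have hf : ∀ x y, f (x * y) = f x * f y := by
    rintro (i | i) (j | j) <;> obtain ⟨k, rfl⟩ := hsurj i <;> obtain ⟨l, rfl⟩ := hsurj j
    · rw [QuaternionGroup.a_mul_a]
      change e _ = e _ * e _
      rw [← Int.cast_add, he, he, he, zpow_add]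
    · rw [QuaternionGroup.a_mul_xa]
      change b * e _ = e _ * (b * e _)
      rw [← Int.cast_sub, he, he, he, ← mul_assoc, hcomm, mul_assoc, ← zpow_add]
      congr 2; ring
    · rw [QuaternionGroup.xa_mul_a]
      change b * e _ = b * e _ * e _
      rw [← Int.cast_add, he, he, he, zpow_add, mul_assoc]
    · rw [QuaternionGroup.xa_mul_xa]
      change e _ = b * e _ * (b * e _)
      have : ((m : ZMod (2 * m)) + l - k) = (((m : ℤ) + l - k : ℤ) : ZMod (2 * m)) := by
        push_cast; rfl
      rw [this, he, he, he, mul_assoc, ← mul_assoc (a ^ k), hcomm, mul_assoc, ← mul_assoc,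
        ← pow_two, hsq, ← zpow_add, ← zpow_natCast, ← zpow_add]
      congr 1; ring
  let φ : QuaternionGroup m →* G := MonoidHom.mk' f hf
  refine ⟨(MulEquiv.ofBijective φ ⟨?_, ?_⟩).symm⟩
  · rw [injective_iff_map_eq_one]
    rintro (i | i) h <;> obtain ⟨k, rfl⟩ := hsurj i
    · change e _ = 1 at h
      rw [he, ← orderOf_dvd_iff_zpow_eq_one, ha] at h
      rw [(ZMod.intCast_zmod_eq_zero_iff_dvd k (2 * m)).mpr h, QuaternionGroup.a_zero]
    · change b * e _ = 1 at h
      rw [he] at h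
      refine absurd ?_ hb
      rw [eq_inv_of_mul_eq_one_left h]
      exact inv_mem (Subgroup.zpow_mem _ (Subgroup.mem_zpowers a) _)
  · intro g
    by_cases hg : g ∈ Subgroup.zpowers a
    · obtain ⟨k, rfl⟩ := Subgroup.mem_zpowers_iff.mp hg
      exact ⟨.a k, he k⟩
    · obtain ⟨k, hk⟩ := Subgroup.mem_zpowers_iff.mp (hcov g hg)
      refine ⟨.xa k, ?_⟩
      change b * e _ = g
      rw [he, hk]; group

/-- A finite `p`-group has a normal cyclic subgroup of maximal order. -/
theorem IsPGroup.exists_maximal_normal_zpowers {G : Type*} [Group G] [Finite G] [Nontrivial G]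
    {p : ℕ} [Fact p.Prime] (hG : IsPGroup p G) :
    ∃ a : G, a ≠ 1 ∧ (Subgroup.zpowers a).Normal ∧
      ∀ c : G, (Subgroup.zpowers c).Normal → orderOf c ≤ orderOf a := by
  have h1 : (Subgroup.zpowers (1 : G)).Normal := by
    rw [Subgroup.zpowers_one_eq_bot]; infer_instance
  obtain ⟨a, ha, hmax⟩ := (Set.toFinite {c : G | (Subgroup.zpowers c).Normal}).exists_maximalFor
    orderOf _ ⟨1, h1⟩
  have hmax' : ∀ c : G, (Subgroup.zpowers c).Normal → orderOf c ≤ orderOf a := fun c hc =>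
    (le_total (orderOf c) (orderOf a)).elim id (fun h => hmax hc h)
  refine ⟨a, ?_, ha, hmax'⟩
  rintro rfl
  have := hG.center_nontrivial
  obtain ⟨⟨z, hz⟩, hz1⟩ := exists_ne (1 : Subgroup.center G)
  have hzn : (Subgroup.zpowers z).Normal := by
    refine ⟨fun y hy g => ?_⟩
    have hyc : y ∈ Subgroup.center G := (Subgroup.zpowers_le.mpr hz) hy
    rw [Subgroup.mem_center_iff.mp hyc g, mul_inv_cancel_right]
    exact hy
  have := hmax' z hzn
  rw [orderOf_one] at this
  have h3 : orderOf z = 1 := le_antisymm this (orderOf_pos z)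
  exact hz1 (Subtype.ext (orderOf_eq_one_iff.mp h3))

/-- In a finite `2`-group with at most one involution, an element outside a maximal normal
cyclic subgroup `⟨a⟩` whose square lies in `⟨a⟩` inverts `a`. -/
theorem conj_eq_inv_of_sq_mem_zpowers {G : Type*} [Group G] {n : ℕ} {a b : G}
    (ha : orderOf a = 2 ^ (n + 1)) (hU : ∀ x : G, x ^ 2 = 1 → x ∈ Subgroup.zpowers a)
    (hU' : ∀ x y : G, x ^ 2 = 1 → y ^ 2 = 1 → x ≠ 1 → y ∈ Subgroup.zpowers x)
    (hC : ∀ g : G, Commute g a → g ∈ Subgroup.zpowers a)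
    (hb : b ∉ Subgroup.zpowers a) (hb2 : b ^ 2 ∈ Subgroup.zpowers a) {s : ℤ}
    (h : b * a * b⁻¹ = a ^ s) : b * a * b⁻¹ = a⁻¹ ∧ b ^ 4 = 1 := by
  have hdvd : ∀ i : ℤ, a ^ i = 1 ↔ (2 : ℤ) ^ (n + 1) ∣ i := fun i => by
    rw [← orderOf_dvd_iff_zpow_eq_one, ha]; push_cast; rfl
  have hnotmem : a ∉ Subgroup.zpowers b := fun hab => hb <| hC b <| by
    obtain ⟨k, rfl⟩ := Subgroup.mem_zpowers_iff.mp hab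
    exact (Commute.refl b).zpow_right k
  have hs2 : (2 : ℤ) ^ (n + 1) ∣ s ^ 2 - 1 := by
    rw [← hdvd, zpow_sub, ← conj_pow_of_conj h]
    obtain ⟨k, hk⟩ := Subgroup.mem_zpowers_iff.mp hb2
    rw [← hk]; group
  have hsodd : s % 2 = 1 := by
    have h2 : (2 : ℤ) ∣ s ^ 2 - 1 := (dvd_pow_self 2 (by omega)).trans hs2
    rcases Int.emod_two_eq_zero_or_one s with h0 | h0
    · obtain ⟨t, rfl⟩ := Int.dvd_of_emod_eq_zero h0
      obtain ⟨r, hr⟩ := h2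
      have : 2 * (2 * t ^ 2 - r) = 1 := by linear_combination hr
      omega
    · exact h0
  -- If `s ≡ 1` modulo 4, the norm `1 + s` is twice an odd number and `a` would be a power of `b`.
  have hs3 : s % 4 = 3 := by
    by_contra hne
    refine hnotmem (mem_zpowers_of_conj_of_norm Nat.prime_two (u := (1 + s) / 2) ha hU hb hb2 h
      ?_ ?_)
    · simp [Finset.sum_range_succ]; omega
    · push_cast; omega
  obtain ⟨t, rfl⟩ : ∃ t : ℤ, s = 4 * t + 3 := ⟨s / 4, by omega⟩
  have hodd : ∀ r : ℤ, IsCoprime ((2 : ℤ) ^ (n + 1)) (2 * r + 1) := fun r =>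
    IsCoprime.pow_left ⟨-r, 1, by ring⟩
  obtain ⟨k, hk⟩ := Subgroup.mem_zpowers_iff.mp hb2
  -- `b` commutes with `b ^ 2 = a ^ k`, so `(s - 1) * k` is zero modulo the order of `a`; the odd
  -- factor `2 * t + 1` of `s - 1` cancels.
  have hk2 : (2 : ℤ) ^ (n + 1) ∣ k * 2 := by
    have h1 := conj_zpow_of_conj h k
    rw [hk] at h1
    have h2 : a ^ ((4 * t + 3) * k - k) = 1 := by
      rw [zpow_sub, hk, mul_inv_eq_one]
      refine mul_right_cancel (h1.symm.trans ?_)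
      rw [← pow_succ', ← pow_succ]
    rw [hdvd] at h2
    have h3 : (2 : ℤ) ^ (n + 1) ∣ k * 2 * (2 * t + 1) := by convert h2 using 1; ring
    exact (hodd t).dvd_of_dvd_mul_right h3
  have hb4 : b ^ 4 = 1 := by
    rw [show 4 = 2 * 2 from rfl, pow_mul, ← hk, ← zpow_natCast, ← zpow_mul]
    exact (hdvd _).mpr (by exact_mod_cast hk2)
  have hb21 : b ^ 2 ≠ 1 := fun h1 => hb (hU b h1)
  -- Factor `s ^ 2 - 1 = (s + 1) * 2 * (2 * t + 1)` and cancel the odd factor.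
  have hy : (a ^ (4 * t + 3 + 1)) ^ 2 = 1 := by
    rw [← zpow_natCast, ← zpow_mul, hdvd]
    have h3 : (2 : ℤ) ^ (n + 1) ∣ (4 * t + 3 + 1) * (2 : ℕ) * (2 * t + 1) := by
      convert hs2 using 1; push_cast; ring
    exact (hodd t).dvd_of_dvd_mul_right h3
  obtain ⟨j, hj⟩ := Subgroup.mem_zpowers_iff.mp
    (hU' (b ^ 2) _ (by rw [← pow_mul]; exact hb4) hy hb21)
  refine ⟨?_, hb4⟩
  -- By uniqueness of the involution `a ^ (s + 1)` is `1` or `b ^ 2`; in the second case `(a * b) ^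
  -- 2 = b ^ 4 = 1` puts `b` in `⟨a⟩`.
  have hmain : a ^ (4 * t + 3 + 1) = 1 := by
    rcases Int.even_or_odd' j with ⟨i, rfl | rfl⟩
    · rw [← hj, zpow_mul, zpow_ofNat, ← pow_mul, hb4, one_zpow]
    · exfalso
      have h1 : a ^ (4 * t + 3 + 1) = b ^ 2 := by
        rw [← hj, zpow_add, zpow_mul, zpow_ofNat, ← pow_mul, hb4]; simp
      have h2 : (a * b) ^ 2 = 1 := by
        have := zpow_mul_pow_of_conj h 1 2
        rw [zpow_one] at this
        rw [this]
        have h3 : 1 * ∑ i ∈ Finset.range 2, (4 * t + 3) ^ i = 4 * t + 3 + 1 := by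
          simp [Finset.sum_range_succ]; ring
        rw [h3, h1, ← pow_add, hb4]
      exact hb ((Subgroup.mul_mem_cancel_left _ (Subgroup.mem_zpowers a)).mp (hU _ h2))
  rw [h]
  rw [zpow_add_one] at hmain
  exact eq_inv_of_mul_eq_one_left hmain

/-- A finite `p`-group with at most one subgroup of order `p` is cyclic or generalized
quaternion. -/
theorem IsPGroup.isCyclic_or_isGeneralizedQuaternion {G : Type*} [Group G] [Finite G] {p : ℕ}
    [hp : Fact p.Prime] (hG : IsPGroup p G)
    (hU' : ∀ x y : G, x ^ p = 1 → y ^ p = 1 → x ≠ 1 → y ∈ Subgroup.zpowers x) :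
    IsCyclic G ∨ IsGeneralizedQuaternion G := by
  rcases subsingleton_or_nontrivial G with hsub | hnt
  · exact Or.inl inferInstance
  obtain ⟨a, ha1, hA, hmax⟩ := hG.exists_maximal_normal_zpowers
  by_cases hall : ∀ g : G, g ∈ Subgroup.zpowers a
  · exact Or.inl ⟨a, hall⟩
  refine Or.inr ?_
  obtain ⟨N, hN⟩ := (IsPGroup.iff_orderOf.mp hG) a
  obtain ⟨n, rfl⟩ : ∃ n, N = n + 1 := Nat.exists_eq_succ_of_ne_zero (by
    rintro rfl; exact ha1 (orderOf_eq_one_iff.mp (by simpa using hN)))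
  have hU : ∀ x : G, x ^ p = 1 → x ∈ Subgroup.zpowers a := by
    intro x hx
    have hx0 : a ^ p ^ n ≠ 1 := fun h => by
      have := orderOf_dvd_of_pow_eq_one h
      rw [hN, Nat.pow_dvd_pow_iff_le_right hp.out.one_lt] at this
      omega
    have h1 := hU' (a ^ p ^ n) x (by rw [← pow_mul, ← pow_succ, ← hN, pow_orderOf_eq_one]) hx hx0
    exact Subgroup.zpowers_le.mpr (Subgroup.pow_mem _ (Subgroup.mem_zpowers a) _) h1
  have hC : ∀ g : G, Commute g a → g ∈ Subgroup.zpowers a := fun g hg =>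
    hG.mem_zpowers_of_commute_of_maximal hU hmax hg
  have hconj : ∀ g : G, ∃ s : ℤ, g * a * g⁻¹ = a ^ s := fun g => by
    obtain ⟨s, hs⟩ := Subgroup.mem_zpowers_iff.mp (hA.conj_mem a (Subgroup.mem_zpowers a) g)
    exact ⟨s, hs.symm⟩
  have hdvd : ∀ i : ℤ, a ^ i = 1 ↔ (p : ℤ) ^ (n + 1) ∣ i := fun i => by
    rw [← orderOf_dvd_iff_zpow_eq_one, hN]; push_cast; rfl
  push Not at hall
  obtain ⟨g, hg⟩ := hall
  have hchain : ∀ g : G, ∃ j, g ^ p ^ j ∈ Subgroup.zpowers a := fun g => by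
    obtain ⟨j, hj⟩ := hG g
    exact ⟨j, hj ▸ one_mem _⟩
  -- For odd `p`, take the last iterated `p`-th power `b` of `g` outside `⟨a⟩`. Fermat gives `s ≡ 1`
  -- modulo `p`, so `a` is a power of `b`; then `b` centralizes `a`, hence lies in `⟨a⟩`.
  obtain rfl : p = 2 := by
    classical
    by_contra hp2
    have hj := Nat.find_spec (hchain g)
    obtain ⟨i, hi⟩ : ∃ i, Nat.find (hchain g) = i + 1 := Nat.exists_eq_succ_of_ne_zero fun h => by
      rw [h] at hj; simp [hg] at hj
    have hb := Nat.find_min (hchain g) (m := i) (by omega)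
    rw [hi, pow_succ, pow_mul] at hj
    obtain ⟨s, hs⟩ := hconj (g ^ p ^ i)
    have hsp : (p : ℤ) ∣ s ^ p - 1 := by
      refine (dvd_pow_self (p : ℤ) (Nat.succ_ne_zero n)).trans ?_
      rw [← hdvd, zpow_sub, ← conj_pow_of_conj hs]
      obtain ⟨k, hk⟩ := Subgroup.mem_zpowers_iff.mp hj
      rw [← hk]; group
    have hs1 : (p : ℤ) ∣ s - 1 := by
      rw [← ZMod.intCast_zmod_eq_zero_iff_dvd] at hsp ⊢
      push_cast at hsp ⊢
      rwa [ZMod.pow_card] at hsp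
    obtain ⟨u, hu, hu'⟩ := exists_sum_pow_eq_mul_of_modEq_one hp.out hp2 hs1
    have hab := mem_zpowers_of_conj_of_norm hp.out hN hU hb hj hs hu hu'
    refine hb (hC _ ?_)
    obtain ⟨k, hk⟩ := Subgroup.mem_zpowers_iff.mp hab
    rw [← hk]
    exact (Commute.refl _).zpow_right k
  have hkey : ∀ b : G, b ∉ Subgroup.zpowers a → b ^ 2 ∈ Subgroup.zpowers a →
      b * a * b⁻¹ = a⁻¹ ∧ b ^ 4 = 1 := fun b hb hb2 =>
    conj_eq_inv_of_sq_mem_zpowers hN hU hU' hC hb hb2 (hconj b).choose_spec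
  have hn : ∀ b : G, b ∉ Subgroup.zpowers a → b ^ 2 ∈ Subgroup.zpowers a → 1 ≤ n := by
    intro b hb hb2
    by_contra hn0
    obtain rfl : n = 0 := by omega
    have h2 : a⁻¹ = a := by
      have := pow_orderOf_eq_one a
      rw [hN] at this
      rw [inv_eq_iff_mul_eq_one, ← pow_two]; simpa using this
    have h1 := (hkey b hb hb2).1
    rw [h2] at h1
    exact hb (hC b (mul_inv_eq_iff_eq_mul.mp h1))
  -- Otherwise an element inverting `a` is a square of one acting by `s`, so `s ^ 2 ≡ -1` modulo 4,
  -- as `4` divides the order of `a`.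
  have hsq : ∀ b : G, b ^ 2 ∈ Subgroup.zpowers a := by
    classical
    intro b
    by_contra hb
    have hj := Nat.find_spec (hchain b)
    obtain ⟨i, hi⟩ : ∃ i, Nat.find (hchain b) = i + 2 := by
      refine ⟨Nat.find (hchain b) - 2, ?_⟩
      have h0 : Nat.find (hchain b) ≠ 0 := fun h => by
        rw [h] at hj; exact hb (Subgroup.pow_mem _ (by simpa using hj) 2)
      have h1 : Nat.find (hchain b) ≠ 1 := fun h => by
        rw [h] at hj; exact hb (by simpa using hj)
      omega
    have hd := Nat.find_min (hchain b) (m := i + 1) (by omega)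
    rw [hi, pow_succ, pow_mul] at hj
    have h1 := (hkey _ hd hj).1
    have hn1 := hn _ hd hj
    obtain ⟨s, hs⟩ := hconj (b ^ 2 ^ i)
    rw [pow_succ, pow_mul, conj_pow_of_conj hs] at h1
    have h2 : a ^ (s ^ 2 + 1) = 1 := by rw [zpow_add_one, h1]; group
    rw [hdvd] at h2
    have h4 : (4 : ℤ) ∣ s ^ 2 + 1 := by
      refine Dvd.dvd.trans ?_ h2
      obtain ⟨l, rfl⟩ : ∃ l, n = l + 1 := ⟨n - 1, by omega⟩
      exact ⟨2 ^ l, by push_cast; ring⟩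
    rcases Int.even_or_odd' s with ⟨i, rfl | rfl⟩
    · obtain ⟨r, hr⟩ := h4
      have : 4 * (r - i ^ 2) = 1 := by linear_combination -hr
      omega
    · obtain ⟨r, hr⟩ := h4
      have : 4 * (r - i ^ 2 - i) = 2 := by linear_combination -hr
      omega
  have hn1 := hn g hg (hsq g)
  obtain ⟨hinv, hg4⟩ := hkey g hg (hsq g)
  refine ⟨n + 2, by omega, ?_⟩
  rw [Nat.add_sub_cancel]
  refine nonempty_mulEquiv_quaternionGroup (a := a) (b := g) (by rw [hN, pow_succ']) hg hinv ?_ ?_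
  · have ham : (a ^ 2 ^ n) ^ 2 = 1 := by rw [← pow_mul, ← pow_succ, ← hN, pow_orderOf_eq_one]
    have hg2 : (g ^ 2) ^ 2 = 1 := by rw [← pow_mul]; exact hg4
    have ham1 : a ^ 2 ^ n ≠ 1 := fun h => by
      have := orderOf_dvd_of_pow_eq_one h
      rw [hN, Nat.pow_dvd_pow_iff_le_right one_lt_two] at this
      omega
    obtain ⟨j, hj⟩ := Subgroup.mem_zpowers_iff.mp (hU' _ _ ham hg2 ham1)
    rcases Int.even_or_odd' j with ⟨i, rfl | rfl⟩
    · rw [zpow_mul, zpow_ofNat, ham, one_zpow] at hj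
      exact absurd (hU g hj.symm) hg
    · rw [zpow_add, zpow_mul, zpow_ofNat, ham, one_zpow, one_mul, zpow_one] at hj
      exact hj.symm
  -- Both `g` and `x` invert `a`, so `g⁻¹ * x` centralizes it.
  · intro x hx
    refine hC _ ?_
    have h1 := (hkey x hx (hsq x)).1
    have h2 : g⁻¹ * a⁻¹ * g = a := by
      rw [← hinv]; group
    have h3 : g⁻¹ * x * a * (g⁻¹ * x)⁻¹ = a := by
      calc g⁻¹ * x * a * (g⁻¹ * x)⁻¹ = g⁻¹ * (x * a * x⁻¹) * g := by group
        _ = a := by rw [h1, h2]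
    exact mul_inv_eq_iff_eq_mul.mp h3

/-! ### Subgroups of finite cyclic groups. -/

/-- A subgroup of a finite cyclic group `⟨w⟩` is determined by its order. -/
theorem Subgroup.eq_zpowers_pow_of_le_zpowers {G : Type*} [Group G] [Finite G] {w : G}
    {C : Subgroup G} (hC : C ≤ zpowers w) : C = zpowers (w ^ (orderOf w / Nat.card C)) := by
  have hd : Nat.card C ∣ orderOf w := by
    rw [← Nat.card_zpowers]; exact card_dvd_of_le hC
  obtain ⟨m, hm⟩ := hd
  have hcpos : 0 < Nat.card C := Nat.card_pos
  have hm0 : m ≠ 0 := by rintro rfl; exact (orderOf_pos w).ne' (by simpa using hm)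
  have hq : orderOf w / Nat.card C = m := by rw [hm]; exact Nat.mul_div_cancel_left _ hcpos
  rw [hq]
  have hle : C ≤ zpowers (w ^ m) := by
    intro x hx
    obtain ⟨i, rfl⟩ := mem_zpowers_iff.mp (hC hx)
    have h1 : (w ^ i) ^ Nat.card C = 1 := by
      exact congrArg Subtype.val (pow_card_eq_one' (x := (⟨w ^ i, hx⟩ : C)))
    rw [← zpow_natCast, ← zpow_mul, ← orderOf_dvd_iff_zpow_eq_one, hm] at h1
    obtain ⟨t, ht⟩ := h1
    have hi : i = m * t := by
      have : (Nat.card C : ℤ) ≠ 0 := by exact_mod_cast hcpos.ne'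
      refine mul_left_cancel₀ this ?_
      push_cast at ht
      linear_combination ht
    refine mem_zpowers_iff.mpr ⟨t, ?_⟩
    rw [hi, zpow_mul, zpow_natCast]
  refine eq_of_le_of_card_ge hle ?_
  rw [Nat.card_zpowers, orderOf_pow_of_dvd hm0 ⟨Nat.card C, by rw [hm, mul_comm]⟩, hm,
    Nat.mul_div_cancel _ (Nat.pos_of_ne_zero hm0)]

theorem Subgroup.eq_of_card_eq_of_le_zpowers {G : Type*} [Group G] [Finite G] {w : G}
    {C C' : Subgroup G} (hC : C ≤ zpowers w) (hC' : C' ≤ zpowers w)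
    (h : Nat.card C = Nat.card C') : C = C' := by
  rw [eq_zpowers_pow_of_le_zpowers hC, eq_zpowers_pow_of_le_zpowers hC', h]

theorem Subgroup.exists_le_zpowers_card_eq {G : Type*} [Group G] [Finite G] {x : G} {p : ℕ}
    (hp : p ∣ orderOf x) : ∃ C ≤ zpowers x, Nat.card C = p := by
  obtain ⟨m, hm⟩ := hp
  have hm0 : m ≠ 0 := by rintro rfl; exact (orderOf_pos x).ne' (by simpa using hm)
  refine ⟨zpowers (x ^ m), zpowers_le.mpr (Subgroup.pow_mem _ (mem_zpowers x) m), ?_⟩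
  rw [Nat.card_zpowers, orderOf_pow_of_dvd hm0 ⟨p, by rw [hm, mul_comm]⟩, hm,
    Nat.mul_div_cancel _ (Nat.pos_of_ne_zero hm0)]

theorem Subgroup.exists_zpowers_eq_of_card_prime {G : Type*} [Group G] {p : ℕ} (hp : p.Prime)
    {C : Subgroup G} (hC : Nat.card C = p) : ∃ c : G, zpowers c = C ∧ orderOf c = p := by
  have : Fact p.Prime := ⟨hp⟩
  have := isCyclic_of_prime_card hC
  obtain ⟨c, hc⟩ := C.isCyclic_iff_exists_zpowers_eq_top.mp this
  exact ⟨c, hc, by rw [← Nat.card_zpowers, hc, hC]⟩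

/-! ### Adjacency and dominating vertices. -/

namespace enhancedPowerGraph

theorem adj_of_mem_zpowers {G : Type*} [Group G] {x y : G} (hne : x ≠ y)
    (h : y ∈ Subgroup.zpowers x) : (enhancedPowerGraph G).Adj x y :=
  ⟨hne, x, Subgroup.mem_zpowers x, h⟩

variable {G : Type*} [Group G] [Finite G]

/-- Both subgroups lie in the cyclic group witnessing adjacency. Every lower bound rests on this
rigidity. -/
theorem eq_of_adj {x y : G} (h : (enhancedPowerGraph G).Adj x y) {C C' : Subgroup G}
    (hC : C ≤ Subgroup.zpowers x) (hC' : C' ≤ Subgroup.zpowers y)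
    (hcard : Nat.card C = Nat.card C') : C = C' := by
  obtain ⟨-, w, hx, hy⟩ := h
  exact Subgroup.eq_of_card_eq_of_le_zpowers (hC.trans (Subgroup.zpowers_le.mpr hx))
    (hC'.trans (Subgroup.zpowers_le.mpr hy)) hcard

theorem universalVerts_eq_one
    (hSylow : ∀ p ∈ (Nat.card G).primeFactors, ∀ P : Sylow p G,
      ¬ IsCyclic P ∧ ¬ IsGeneralizedQuaternion P) :
    (enhancedPowerGraph G).universalVerts = {1} := by
  ext x
  simp only [Set.mem_singleton_iff]
  constructor
  · intro hx
    by_contra hx1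
    obtain ⟨p, hp, hpx⟩ := Nat.exists_prime_and_dvd (mt orderOf_eq_one_iff.mp hx1)
    have := Fact.mk hp
    obtain ⟨C, hCx, hC⟩ := Subgroup.exists_le_zpowers_card_eq hpx
    -- A dominating `x` is adjacent or equal to each `y` of order `p`, so all of them generate the
    -- same subgroup `C`.
    have hall : ∀ y : G, y ^ p = 1 → y ≠ 1 → Subgroup.zpowers y = C := by
      intro y hy hy1
      have hcard : Nat.card (Subgroup.zpowers y) = Nat.card C := by
        rw [Nat.card_zpowers, hC, orderOf_eq_prime hy hy1]
      by_cases hxy : x = y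
      · subst hxy
        exact Subgroup.eq_of_card_eq_of_le_zpowers le_rfl hCx hcard
      · exact (eq_of_adj (hx hxy) hCx le_rfl hcard.symm).symm
    obtain ⟨P⟩ : Nonempty (Sylow p G) := inferInstance
    have hpG : p ∈ (Nat.card G).primeFactors :=
      Nat.mem_primeFactors.mpr ⟨hp, hpx.trans (orderOf_dvd_natCard x), Nat.card_pos.ne'⟩
    obtain ⟨h1, h2⟩ := hSylow p hpG P
    refine (P.isPGroup'.isCyclic_or_isGeneralizedQuaternion ?_).elim h1 h2
    intro y z hy hz hy1
    by_cases hz1 : z = 1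
    · rw [hz1]; exact one_mem _
    have hy' := hall y (by exact_mod_cast congrArg Subtype.val hy) (by simpa using hy1)
    have hz' := hall z (by exact_mod_cast congrArg Subtype.val hz) (by simpa using hz1)
    have hmem : (z : G) ∈ Subgroup.zpowers (y : G) := by
      rw [hy', ← hz']; exact Subgroup.mem_zpowers _
    obtain ⟨k, hk⟩ := Subgroup.mem_zpowers_iff.mp hmem
    exact Subgroup.mem_zpowers_iff.mpr ⟨k, Subtype.ext (by simpa using hk)⟩
  · rintro rfl y hy
    exact (adj_of_mem_zpowers (Ne.symm hy) (one_mem _)).symm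

end enhancedPowerGraph

/-! ### Bounds by indexed families, and the `p`-group case. -/

theorem strongDominationNumber_le {V : Type*} {Γ : SimpleGraph V} {D : Set V}
    (hD : IsTotalDominatingSet Γ D) : strongDominationNumber Γ ≤ D.encard :=
  iInf_le (fun D : {D : Set V // IsTotalDominatingSet Γ D} => D.1.encard) ⟨D, hD⟩

theorem strongDominationNumber_le_natCard {V ι : Type*} [Finite ι] {Γ : SimpleGraph V} {f : ι → V}
    (hf : IsTotalDominatingSet Γ (Set.range f)) : strongDominationNumber Γ ≤ Nat.card ι := by
  refine (strongDominationNumber_le hf).trans ?_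
  rw [← Set.image_univ, ← ENat.card_eq_coe_natCard, ← Set.encard_univ]
  exact Set.encard_image_le _ _

theorem natCard_le_encard_of_injective {V ι : Type*} [Finite ι] {D : Set V} {f : ι → V}
    (hf : Function.Injective f) (hD : ∀ i, f i ∈ D) : (Nat.card ι : ℕ∞) ≤ D.encard := by
  rw [← ENat.card_eq_coe_natCard]
  exact hf.encard_range.trans <| Set.encard_le_encard (Set.range_subset_iff.mpr hD)

namespace properEnhancedPowerGraph

variable {G : Type*} [Group G] [Finite G]

/-- The strong domination number of the proper enhanced power graph of a finite `p`-group whose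
only dominating vertex is the identity. -/
theorem strongDominationNumber_of_isPGroup {p : ℕ} (hp : p.Prime) (hG : IsPGroup p G)
    (hV : (enhancedPowerGraph G).universalVerts = {1})
    (hD : ∃ D, IsTotalDominatingSet (properEnhancedPowerGraph G) D) :
    strongDominationNumber (properEnhancedPowerGraph G) = 2 * (numSubgroupsOfOrder p G : ℕ∞) := by
  have := Fact.mk hp
  have hvert : ∀ x : G, x ∈ (enhancedPowerGraph G).universalVertsᶜ ↔ x ≠ 1 := fun x => by
    rw [hV]; rfl
  let S := {H : Subgroup G // Nat.card H = p}
  have hgen : ∀ C : S, ∃ c : ↥((enhancedPowerGraph G).universalVertsᶜ),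
      Subgroup.zpowers (c : G) = C.1 := fun C => by
    obtain ⟨c, hc, hord⟩ := Subgroup.exists_zpowers_eq_of_card_prime hp C.2
    exact ⟨⟨c, (hvert c).mpr fun h => hp.one_lt.ne (by rw [← hord, h, orderOf_one])⟩, hc⟩
  choose c hc using hgen
  have hsoc : ∀ u : ↥((enhancedPowerGraph G).universalVertsᶜ), ∃ C : S,
      C.1 ≤ Subgroup.zpowers (u : G) := fun u => by
    obtain ⟨C, hC, hcard⟩ := Subgroup.exists_le_zpowers_card_eq
      (hG.dvd_orderOf ((hvert u).mp u.2))
    exact ⟨⟨C, hcard⟩, hC⟩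
  have hcardS : (Nat.card (S × Bool) : ℕ∞) = 2 * (numSubgroupsOfOrder p G : ℕ∞) := by
    rw [Nat.card_prod, mul_comm]; simp [numSubgroupsOfOrder, S]
  rw [← hcardS]
  refine le_antisymm ?_ (le_iInf ?_)
  -- The given set only supplies a neighbour `d C` of each generator `c C`, which might otherwise be
  -- isolated.
  · obtain ⟨D, hD⟩ := hD
    choose d hdD hd using fun C : S => hD (c C)
    refine strongDominationNumber_le_natCard (f := fun i : S × Bool =>
      if i.2 then c i.1 else d i.1) fun u => ?_
    obtain ⟨C, hC⟩ := hsoc u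
    by_cases huc : u = c C
    · exact ⟨d C, ⟨(C, false), by simp⟩, huc ▸ hd C⟩
    · refine ⟨c C, ⟨(C, true), by simp⟩, ?_⟩
      exact enhancedPowerGraph.adj_of_mem_zpowers (fun h => huc (Subtype.ext h))
        (hC (hc C ▸ Subgroup.mem_zpowers _))
  · rintro ⟨D, hD⟩
    -- `v C` dominates `c C` and `w C` dominates `v C`; both stay in the class of `C` and they
    -- differ, giving two vertices of `D` per class.
    choose v hvD hv using fun C : S => hD (c C)
    choose w hwD hw using fun C : S => hD (v C)
    have step : ∀ {x y : ↥((enhancedPowerGraph G).universalVertsᶜ)},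
        (properEnhancedPowerGraph G).Adj x y → ∀ C : S, C.1 ≤ Subgroup.zpowers (x : G) →
          C.1 ≤ Subgroup.zpowers (y : G) := by
      intro x y hxy C hC
      obtain ⟨C', hC'⟩ := hsoc y
      rwa [enhancedPowerGraph.eq_of_adj hxy hC hC' (C.2.trans C'.2.symm)]
    have hvC : ∀ C : S, C.1 ≤ Subgroup.zpowers (v C : G) := fun C => step (hv C) C (hc C).ge
    have hwC : ∀ C : S, C.1 ≤ Subgroup.zpowers (w C : G) := fun C => step (hw C) C (hvC C)
    refine natCard_le_encard_of_injective (f := fun i : S × Bool =>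
      if i.2 then v i.1 else w i.1) ?_ ?_
    · have hle : ∀ i : S × Bool, i.1.1 ≤ Subgroup.zpowers
          ((if i.2 then v i.1 else w i.1 : ↥((enhancedPowerGraph G).universalVertsᶜ)) : G) := by
        rintro ⟨C, b⟩
        cases b
        · simpa using hwC C
        · simpa using hvC C
      intro i j hij
      have h1 : i.1 = j.1 := by
        refine Subtype.ext (Subgroup.eq_of_card_eq_of_le_zpowers (hle i) ?_
          (i.1.2.trans j.1.2.symm))
        simp only at hij
        rw [hij]; exact hle j
      obtain ⟨C, b⟩ := i
      obtain ⟨C', b'⟩ := j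
      obtain rfl : C = C' := h1
      cases b <;> cases b' <;> simp at hij ⊢
      · exact (hw C).ne hij.symm
      · exact (hw C).ne hij
    · rintro ⟨C, b⟩
      cases b
      · simpa using hwD C
      · simpa using hvD C

end properEnhancedPowerGraph

/-! ### Elements of coprime order in nilpotent groups. -/

/-- In the product of the Sylow subgroups, each coordinate of `x` or of `y` is trivial. -/
theorem Group.IsNilpotent.commute_of_coprime_orderOf {G : Type*} [Group G] [Finite G]
    (hG : Group.IsNilpotent G) {x y : G} (h : (orderOf x).Coprime (orderOf y)) : Commute x y := by
  obtain ⟨e⟩ := (Group.isNilpotent_of_finite_tfae (G := G).out 0 4 rfl rfl).mp hG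
  suffices hs : Commute (e.symm x) (e.symm y) by
    simpa using hs.map e
  refine funext fun p => funext fun P => ?_
  have hp : Fact (Nat.Prime p) := ⟨Nat.prime_of_mem_primeFactors p.2⟩
  let ev : G →* P := ((Pi.evalMonoidHom _ P).comp (Pi.evalMonoidHom _ p)).comp e.symm.toMonoidHom
  change ev x * ev y = ev y * ev x
  by_cases hx : ev x = 1
  · simp [hx]
  by_cases hy : ev y = 1
  · simp [hy]
  have h1 := (P.isPGroup'.dvd_orderOf hx).trans (orderOf_map_dvd ev x)
  have h2 := (P.isPGroup'.dvd_orderOf hy).trans (orderOf_map_dvd ev y)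
  exact absurd (Nat.eq_one_of_dvd_coprimes h h1 h2) hp.out.one_lt.ne'

/-- Raising `x * y` to the order of `y` kills `y` and leaves a generator of `⟨x⟩`. -/
theorem Commute.left_mem_zpowers_mul_of_coprime {G : Type*} [Group G] {x y : G}
    (hc : Commute x y) (h : (orderOf x).Coprime (orderOf y)) :
    x ∈ Subgroup.zpowers (x * y) := by
  have h1 : x ∈ Subgroup.zpowers (x ^ orderOf y) :=
    mem_zpowers_pow_iff.mpr h.symm
  have h2 : x ^ orderOf y = (x * y) ^ orderOf y := by
    rw [hc.mul_pow, pow_orderOf_eq_one, mul_one]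
  rw [h2] at h1
  exact Subgroup.zpowers_le.mpr (Subgroup.pow_mem _ (Subgroup.mem_zpowers _) _) h1

theorem Commute.right_mem_zpowers_mul_of_coprime {G : Type*} [Group G] {x y : G}
    (hc : Commute x y) (h : (orderOf x).Coprime (orderOf y)) :
    y ∈ Subgroup.zpowers (x * y) := by
  rw [hc.eq]; exact hc.symm.left_mem_zpowers_mul_of_coprime h.symm

/-- In a finite nilpotent group, subgroups of distinct prime orders lie in a common cyclic
subgroup. -/
theorem Group.IsNilpotent.exists_le_zpowers {G : Type*} [Group G] [Finite G]
    (hG : Group.IsNilpotent G) (C : ℕ → Subgroup G) (s : Finset ℕ)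
    (hC : ∀ p ∈ s, p.Prime ∧ Nat.card (C p) = p) :
    ∃ u : G, orderOf u ∣ ∏ p ∈ s, p ∧ ∀ p ∈ s, C p ≤ Subgroup.zpowers u := by
  induction s using Finset.induction_on with
  | empty => exact ⟨1, by simp, by simp⟩
  | insert p s hps ih =>
    obtain ⟨u, hu, hCu⟩ := ih fun q hq => hC q (Finset.mem_insert_of_mem hq)
    obtain ⟨hp, hcard⟩ := hC p (Finset.mem_insert_self p s)
    obtain ⟨c, hc, hord⟩ := Subgroup.exists_zpowers_eq_of_card_prime hp hcard
    have hcop : (orderOf c).Coprime (orderOf u) := by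
      rw [hord]
      refine Nat.Coprime.coprime_dvd_right hu (Nat.Coprime.prod_right fun q hq => ?_)
      refine (Nat.coprime_primes hp (hC q (Finset.mem_insert_of_mem hq)).1).mpr ?_
      rintro rfl; exact hps hq
    have hcomm := hG.commute_of_coprime_orderOf hcop
    refine ⟨c * u, ?_, ?_⟩
    · rw [Finset.prod_insert hps]
      exact hcomm.orderOf_mul_dvd_mul_orderOf.trans (mul_dvd_mul hord.dvd hu)
    · intro q hq
      rcases Finset.mem_insert.mp hq with rfl | hq
      · rw [← hc, Subgroup.zpowers_le]
        exact hcomm.left_mem_zpowers_mul_of_coprime hcop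
      · exact (hCu q hq).trans (Subgroup.zpowers_le.mpr
          (hcomm.right_mem_zpowers_mul_of_coprime hcop))

/-- The Sylow subgroup is normal, hence unique, so it contains every subgroup of order `p`. -/
theorem Group.IsNilpotent.numSubgroupsOfOrder_sylow {G : Type*} [Group G] [Finite G]
    (hG : Group.IsNilpotent G) {p : ℕ} (hp : p.Prime) (P : Sylow p G) :
    numSubgroupsOfOrder p P = numSubgroupsOfOrder p G := by
  have := Fact.mk hp
  have hn : P.Normal := inferInstance
  have := P.unique_of_normal hn
  have hinj := (P : Subgroup G).subtype_injective
  refine Nat.card_eq_of_bijective (fun H : {H : Subgroup P // Nat.card H = p} =>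
    (⟨H.1.map (P : Subgroup G).subtype, by
      rw [Subgroup.card_map_of_injective hinj, H.2]⟩ : {H : Subgroup G // Nat.card H = p}))
    ⟨?_, ?_⟩
  · intro H K h
    exact Subtype.ext (Subgroup.map_injective hinj (congrArg Subtype.val h))
  · rintro ⟨H, hH⟩
    obtain ⟨Q, hQ⟩ := (IsPGroup.of_card (n := 1) (by simpa using hH) : IsPGroup p H).exists_le_sylow
    rw [Subsingleton.elim Q P] at hQ
    have hm : (H.subgroupOf (P : Subgroup G)).map (P : Subgroup G).subtype = H :=
      Subgroup.map_subgroupOf_eq_of_le hQ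
    refine ⟨⟨H.subgroupOf P, ?_⟩, Subtype.ext hm⟩
    rw [← Subgroup.card_map_of_injective hinj, hm, hH]

/-! ### Upper and lower bounds for several primes. -/

namespace properEnhancedPowerGraph

variable {G : Type*} [Group G] [Finite G]

theorem strongDominationNumber_le_of_isNilpotent (hG : Group.IsNilpotent G)
    (hV : (enhancedPowerGraph G).universalVerts = {1}) {p q : ℕ} (hp : p.Prime) (hq : q.Prime)
    (hpq : p ≠ q) (hpG : p ∣ Nat.card G) (hqG : q ∣ Nat.card G) :
    strongDominationNumber (properEnhancedPowerGraph G) ≤ (numSubgroupsOfOrder p G : ℕ∞) + 1 := by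
  have := Fact.mk hp
  have := Fact.mk hq
  have hvert : ∀ x : G, x ∈ (enhancedPowerGraph G).universalVertsᶜ ↔ x ≠ 1 := fun x => by
    rw [hV]; rfl
  have adj_of_coprime : ∀ x y : ↥((enhancedPowerGraph G).universalVertsᶜ),
      (orderOf (x : G)).Coprime (orderOf (y : G)) → (properEnhancedPowerGraph G).Adj x y := by
    intro x y h
    have hc := hG.commute_of_coprime_orderOf h
    refine ⟨fun hxy => (hvert x).mp x.2 ?_, (x : G) * y, hc.left_mem_zpowers_mul_of_coprime h,
      hc.right_mem_zpowers_mul_of_coprime h⟩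
    change (x : G) = y at hxy
    rw [← hxy, Nat.coprime_self] at h
    exact orderOf_eq_one_iff.mp h
  let S := {H : Subgroup G // Nat.card H = p}
  have hgen : ∀ C : S, ∃ c : ↥((enhancedPowerGraph G).universalVertsᶜ),
      Subgroup.zpowers (c : G) = C.1 ∧ orderOf (c : G) = p := fun C => by
    obtain ⟨c, hc, hord⟩ := Subgroup.exists_zpowers_eq_of_card_prime hp C.2
    exact ⟨⟨c, (hvert c).mpr fun h => hp.one_lt.ne (by rw [← hord, h, orderOf_one])⟩, hc, hord⟩
  choose c hc hcord using hgen
  obtain ⟨z, hz⟩ := exists_prime_orderOf_dvd_card' q hqG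
  let z' : ↥((enhancedPowerGraph G).universalVertsᶜ) :=
    ⟨z, (hvert z).mpr fun h => hq.one_lt.ne (by rw [← hz, h, orderOf_one])⟩
  have hcard : (Nat.card (Option S) : ℕ∞) = (numSubgroupsOfOrder p G : ℕ∞) + 1 := by
    rw [Finite.card_option]; rfl
  rw [← hcard]
  -- The extra vertex `z'`, of order `q`, is needed only to dominate the chosen generators
  -- themselves.
  refine strongDominationNumber_le_natCard (f := fun i : Option S => i.elim z' c) fun u => ?_
  by_cases hpu : p ∣ orderOf (u : G)
  · obtain ⟨C, hC, hCp⟩ := Subgroup.exists_le_zpowers_card_eq hpu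
    by_cases huc : u = c ⟨C, hCp⟩
    · refine ⟨z', ⟨none, rfl⟩, adj_of_coprime _ _ ?_⟩
      rw [huc, hcord]
      exact hz.symm ▸ (Nat.coprime_primes hp hq).mpr hpq
    · refine ⟨c ⟨C, hCp⟩, ⟨some ⟨C, hCp⟩, rfl⟩, ?_⟩
      exact enhancedPowerGraph.adj_of_mem_zpowers (fun h => huc (Subtype.ext h))
        (hC ((hc ⟨C, hCp⟩).le (Subgroup.mem_zpowers _)))
  · obtain ⟨y, hy⟩ := exists_prime_orderOf_dvd_card' p hpG
    let C : S := ⟨Subgroup.zpowers y, by rw [Nat.card_zpowers, hy]⟩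
    refine ⟨c C, ⟨some C, rfl⟩, adj_of_coprime _ _ ?_⟩
    rw [hcord]
    exact ((Nat.Prime.coprime_iff_not_dvd hp).mpr hpu).symm

theorem exists_le_encard_of_isNilpotent (hG : Group.IsNilpotent G) [Nontrivial G]
    (hV : (enhancedPowerGraph G).universalVerts = {1})
    {D : Set ↥((enhancedPowerGraph G).universalVertsᶜ)}
    (hD : IsTotalDominatingSet (properEnhancedPowerGraph G) D) :
    ∃ p ∈ (Nat.card G).primeFactors, (numSubgroupsOfOrder p G : ℕ∞) + 1 ≤ D.encard := by
  have hvert : ∀ x : G, x ∈ (enhancedPowerGraph G).universalVertsᶜ ↔ x ≠ 1 := fun x => by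
    rw [hV]; rfl
  have hsoc : ∀ v : ↥((enhancedPowerGraph G).universalVertsᶜ), ∃ C : Subgroup G,
      C ≤ Subgroup.zpowers (v : G) ∧ (Nat.card C).Prime := fun v => by
    obtain ⟨p, hp, hpv⟩ := Nat.exists_prime_and_dvd
      (mt orderOf_eq_one_iff.mp ((hvert v).mp v.2))
    obtain ⟨C, hC, hcard⟩ := Subgroup.exists_le_zpowers_card_eq hpv
    exact ⟨C, hC, hcard ▸ hp⟩
  choose f hf hfp using hsoc
  -- If each prime had a subgroup `C p` missed by `f` on `D`, some `u` would have all of them in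
  -- `⟨u⟩`. A neighbour `v ∈ D` of `u` has `f v` of some prime order `q`, so `f v = C q`, a
  -- contradiction.
  have hcov : ∃ p ∈ (Nat.card G).primeFactors, ∀ C : Subgroup G, Nat.card C = p →
      ∃ v ∈ D, f v = C := by
    by_contra! hcon
    have hch : ∀ p : ℕ, ∃ C : Subgroup G, p ∈ (Nat.card G).primeFactors →
        Nat.card C = p ∧ ∀ v ∈ D, f v ≠ C := fun p => by
      by_cases hp : p ∈ (Nat.card G).primeFactors
      · obtain ⟨C, hC⟩ := hcon p hp
        exact ⟨C, fun _ => hC⟩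
      · exact ⟨⊥, fun h => absurd h hp⟩
    choose C hC using hch
    obtain ⟨u, -, hu⟩ := hG.exists_le_zpowers C (Nat.card G).primeFactors fun p hp =>
      ⟨Nat.prime_of_mem_primeFactors hp, (hC p hp).1⟩
    have hu1 : u ≠ 1 := by
      rintro rfl
      obtain ⟨p, hp⟩ := Nat.nonempty_primeFactors.mpr (Finite.one_lt_card (α := G))
      have h1 := hu p hp
      rw [Subgroup.zpowers_one_eq_bot, le_bot_iff] at h1
      have h2 := (hC p hp).1
      rw [h1, Subgroup.card_bot] at h2
      exact (Nat.prime_of_mem_primeFactors hp).one_lt.ne h2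
    obtain ⟨v, hvD, huv⟩ := hD ⟨u, (hvert u).mpr hu1⟩
    have hq : Nat.card (f v) ∈ (Nat.card G).primeFactors :=
      Nat.mem_primeFactors.mpr ⟨hfp v, (f v).card_subgroup_dvd_card, Nat.card_pos.ne'⟩
    exact (hC _ hq).2 v hvD
      (enhancedPowerGraph.eq_of_adj huv (hu _ hq) (hf v) (hC _ hq).1).symm
  obtain ⟨p, hp, hcov⟩ := hcov
  refine ⟨p, hp, ?_⟩
  obtain ⟨x, hx⟩ := exists_ne (1 : G)
  obtain ⟨v, hvD, -⟩ := hD ⟨x, (hvert x).mpr hx⟩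
  obtain ⟨w, hwD, hvw⟩ := hD v
  -- One endpoint of the edge `v w` in `D` is redundant: either its subgroup has order other than
  -- `p`, or both endpoints carry the same subgroup. It accounts for the `+ 1`.
  have hdrop : ∃ t ∈ D, ∀ C : Subgroup G, Nat.card C = p → ∃ y ∈ D \ {t}, f y = C := by
    by_cases hvp : Nat.card (f v) = p
    · by_cases hwp : Nat.card (f w) = p
      · have hfe : f v = f w :=
          enhancedPowerGraph.eq_of_adj hvw (hf v) (hf w) (hvp.trans hwp.symm)
        refine ⟨v, hvD, fun C hC => ?_⟩
        obtain ⟨y, hy, rfl⟩ := hcov C hC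
        by_cases hyv : y = v
        · exact ⟨w, ⟨hwD, hvw.ne'⟩, by rw [hyv, hfe]⟩
        · exact ⟨y, ⟨hy, hyv⟩, rfl⟩
      · refine ⟨w, hwD, fun C hC => ?_⟩
        obtain ⟨y, hy, rfl⟩ := hcov C hC
        exact ⟨y, ⟨hy, by rintro rfl; exact hwp hC⟩, rfl⟩
    · refine ⟨v, hvD, fun C hC => ?_⟩
      obtain ⟨y, hy, rfl⟩ := hcov C hC
      exact ⟨y, ⟨hy, by rintro rfl; exact hvp hC⟩, rfl⟩
  obtain ⟨t, htD, ht⟩ := hdrop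
  choose y hyD hy using fun C : {H : Subgroup G // Nat.card H = p} => ht C.1 C.2
  rw [← Set.encard_sdiff_singleton_add_one htD]
  gcongr
  refine natCard_le_encard_of_injective (f := y) (fun C C' h => ?_) hyD
  rw [Subtype.ext_iff, ← hy C, ← hy C', h]

end properEnhancedPowerGraph

/-- In the second part the infimum is over a nonempty family of natural numbers, so the value is not
`⊤`; this encodes the existence of a total dominating set. -/
theorem mainTheorem2 (G : Type*) [Group G] [Finite G] (hG : Group.IsNilpotent G)
    (hSylow : ∀ p ∈ (Nat.card G).primeFactors, ∀ P : Sylow p G,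
      ¬ IsCyclic P ∧ ¬ IsGeneralizedQuaternion P) :
    (∀ p : ℕ, p.Prime → IsPGroup p G →
      (∃ D, IsTotalDominatingSet (properEnhancedPowerGraph G) D) →
        strongDominationNumber (properEnhancedPowerGraph G)
          = 2 * (numSubgroupsOfOrder p G : ℕ∞)) ∧
    (2 ≤ (Nat.card G).primeFactors.card →
      ∀ P : (p : (Nat.card G).primeFactors) → Sylow (p : ℕ) G,
        strongDominationNumber (properEnhancedPowerGraph G)
          = (⨅ p : (Nat.card G).primeFactors, (numSubgroupsOfOrder (p : ℕ) (P p) : ℕ∞)) + 1) := by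
  have hV := enhancedPowerGraph.universalVerts_eq_one hSylow
  refine ⟨fun p hp hpG hD =>
    properEnhancedPowerGraph.strongDominationNumber_of_isPGroup hp hpG hV hD, fun hm P => ?_⟩
  have hnum : ∀ p : (Nat.card G).primeFactors,
      numSubgroupsOfOrder (p : ℕ) (P p) = numSubgroupsOfOrder (p : ℕ) G := fun p =>
    hG.numSubgroupsOfOrder_sylow (Nat.prime_of_mem_primeFactors p.2) (P p)
  simp only [hnum]
  have hne : (Nat.card G).primeFactors.Nonempty := Finset.card_pos.mp (by omega)
  have : Nontrivial G := by
    rw [← Finite.one_lt_card_iff_nontrivial]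
    exact Nat.nonempty_primeFactors.mp hne
  have := hne.to_subtype
  refine le_antisymm ?_ (le_iInf fun D => ?_)
  · obtain ⟨p, hp⟩ := exists_eq_ciInf_of_finite
      (f := fun p : (Nat.card G).primeFactors => (numSubgroupsOfOrder (p : ℕ) G : ℕ∞))
    obtain ⟨q, hq, hqp⟩ := Finset.exists_mem_ne hm (p : ℕ)
    rw [← hp]
    exact properEnhancedPowerGraph.strongDominationNumber_le_of_isNilpotent hG hV
      (Nat.prime_of_mem_primeFactors p.2) (Nat.prime_of_mem_primeFactors hq) hqp.symm
      (Nat.dvd_of_mem_primeFactors p.2) (Nat.dvd_of_mem_primeFactors hq)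
  · obtain ⟨p, hp, hle⟩ :=
      properEnhancedPowerGraph.exists_le_encard_of_isNilpotent hG hV D.2
    refine le_trans ?_ hle
    gcongr
    exact iInf_le (fun p : (Nat.card G).primeFactors => (numSubgroupsOfOrder (p : ℕ) G : ℕ∞))
      ⟨p, hp⟩
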